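/- Let $A$ be a finite-dimensional algebra over a field $K$, let $\mathrm{mod}A$ be the category of finitely generated left $A$-modules, and write $D=\mathrm{Hom}_K(-,K)$. Let $\tau=D\,\mathrm{Tr}$ be the Auslander–Reiten translation, $\Omega$ the syzygy (the kernel of a projective cover), and $\tau_2:=\tau\Omega$. Let $\mathcal{C}\subseteq\mathrm{mod}A$ be a $2$-cluster-tilting subcategory, that is, $$\mathcal{C}=\{X\in\mathrm{mod}A\mid \mathrm{Ext}^1_A(M,X)=0\ \forall M\in\mathcal{C}\}=\{X\in\mathrm{mod}A\mid \mathrm{Ext}^1_A(X,M)=0\ \forall M\in\mathcal{C}\}.$$ For a ring $R$, a finitely generated $R$-module $T$ is called $2$-tilting if $\mathrm{proj.dim}\,T\le 2$, $\mathrm{Ext}^i_R(T,T)=0$ for $i=1,2$, and there is an exact sequence $0\to R\to T_0\to T_1\to T_2\to 0$ with $T_0,T_1,T_2\in\mathrm{add}\,T$. A module $T\in\mathcal{C}$ is called $\tau_2$-tilting if $\mathrm{Hom}_A(T,\tau_2T)=0$ and there is an exact sequence $0\to A\to T_0\to T_1\to T_2\to 0$ with $T_0,T_1,T_2\in\mathrm{add}\,T$.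 Let $\mathrm{ann}\,T=\{a\in A\mid aT=0\}$; the module $T$ is faithful if $\mathrm{ann}\,T=0$. Then: (i) For every $T\in\mathcal{C}$, $\mathrm{proj.dim}\,T\le 2$ if and only if $\mathrm{Hom}_A(DA,\tau_2T)=0$. (ii) If $T\in\mathcal{C}$ is faithful and $\mathrm{Hom}_A(T,\tau_2T)=0$, then $\mathrm{proj.dim}\,T\le 2$. (iii) Every $\tau_2$-tilting $A$-module $T$ is a $2$-tilting $(A/\mathrm{ann}\,T)$-module. -/

import Mathlib

universe u

noncomputable section

namespace HigherAR

open CategoryTheory MulOpposite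

/-! ## Projective covers and syzygies -/

section Cover

variable {A : Type u} [Ring A]

/-- A projective cover: a surjection from a projective module with superfluous kernel. -/
structure IsProjectiveCover {P M : Type u} [AddCommGroup P] [Module A P]
    [AddCommGroup M] [Module A M] (f : P →ₗ[A] M) : Prop where
  projective : Module.Projective A P
  surjective : Function.Surjective f
  superfluous : ∀ N : Submodule A P, N ⊔ LinearMap.ker f = ⊤ → N = ⊤

/-- Finitely generated modules over an Artinian ring have projective covers. -/
theorem exists_projectiveCover [IsArtinianRing A] (M : FGModuleCat.{u} A) :
    ∃ (P : FGModuleCat.{u} A) (f : P →ₗ[A] M), IsProjectiveCover f := by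
  obtain ⟨n, π, hπ⟩ := Module.Finite.exists_fin' A M
  let S : Set (Submodule A (Fin n → A)) :=
    {Q | (∃ Q', IsCompl Q Q') ∧ Function.Surjective (π ∘ₗ Q.subtype)}
  have hS : S.Nonempty := by
    refine ⟨⊤, ⟨⊥, isCompl_top_bot⟩, fun m => ?_⟩
    obtain ⟨x, rfl⟩ := hπ m
    exact ⟨⟨x, trivial⟩, rfl⟩
  obtain ⟨Q, ⟨⟨Q', hQ'⟩, hsurj⟩, hmin⟩ :=
    WellFounded.has_min (wellFounded_lt : WellFounded
      (fun a b : Submodule A (Fin n → A) => a < b)) S hS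
  have hproj : Module.Projective A Q :=
    Module.Projective.of_split Q.subtype (Q.projectionOnto Q' hQ')
      (by ext x; simp)
  refine ⟨FGModuleCat.of A Q, π ∘ₗ Q.subtype, hproj, hsurj, fun N hN => ?_⟩
  let f : Q →ₗ[A] M := π ∘ₗ Q.subtype
  change Submodule A Q at N
  change N ⊔ LinearMap.ker f = ⊤ at hN
  have hfN : Function.Surjective (f ∘ₗ N.subtype) := by
    intro m
    obtain ⟨q, hq⟩ := hsurj m
    have hq' : q ∈ N ⊔ LinearMap.ker f := by rw [hN]; trivial
    obtain ⟨y, hy, z, hz, rfl⟩ := Submodule.mem_sup.1 hq'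
    refine ⟨⟨y, hy⟩, ?_⟩
    have hz' : f z = 0 := hz
    have : f (y + z) = m := hq
    simpa [map_add, hz'] using this
  obtain ⟨g, hg⟩ := Module.projective_lifting_property (f ∘ₗ N.subtype) f hfN
  let h : Module.End A Q := N.subtype ∘ₗ g
  have hfh : ∀ x, f (h x) = f x := fun x => LinearMap.congr_fun hg x
  have hfhk : ∀ (k : ℕ) x, f ((h ^ k) x) = f x := by
    intro k
    induction k with
    | zero => intro x; simp
    | succ k ih => intro x; rw [pow_succ', Module.End.mul_apply, hfh, ih]
  obtain ⟨k, hk, hcompl⟩ : ∃ k : ℕ, 1 ≤ k ∧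
      IsCompl (LinearMap.ker (h ^ k)) (LinearMap.range (h ^ k)) := by
    obtain ⟨k, hk⟩ := Filter.eventually_atTop.1 h.eventually_isCompl_ker_pow_range_pow
    exact ⟨k + 1, by omega, hk _ (by omega)⟩
  -- The stable range of `h` is a direct summand that still surjects onto `M`.
  have hmem : (LinearMap.range (h ^ k)).map Q.subtype ∈ S := by
    refine ⟨⟨(LinearMap.ker (h ^ k)).map Q.subtype ⊔ Q', ?_⟩, ?_⟩
    · constructor
      · rw [Submodule.disjoint_def]
        rintro x ⟨⟨y, hyQ⟩, hy, rfl⟩ hx2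
        obtain ⟨z, ⟨⟨w, hwQ⟩, hw, rfl⟩, v, hv, hzv⟩ := Submodule.mem_sup.1 hx2
        have hzv' : w + v = y := hzv
        have hv0 : v = 0 := by
          refine (Submodule.disjoint_def.1 hQ'.disjoint) v ?_ hv
          have : v = y - w := by rw [← hzv']; abel
          rw [this]
          exact Q.sub_mem hyQ hwQ
        have hwy : (⟨w, hwQ⟩ : Q) = ⟨y, hyQ⟩ := by
          apply Subtype.ext
          simpa [hv0] using hzv'
        have := (Submodule.disjoint_def.1 hcompl.disjoint) ⟨y, hyQ⟩ (hwy ▸ hw) hy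
        simpa using congrArg Subtype.val this
      · rw [codisjoint_iff, ← sup_assoc, ← Submodule.map_sup, sup_comm (LinearMap.range _),
          hcompl.sup_eq_top, Submodule.map_subtype_top, hQ'.sup_eq_top]
    · intro m
      obtain ⟨q, hq⟩ := hsurj m
      exact ⟨⟨((h ^ k) q : Q), ⟨(h ^ k) q, ⟨q, rfl⟩, rfl⟩⟩, (hfhk k q).trans hq⟩
  have hle : (LinearMap.range (h ^ k)).map Q.subtype ≤ Q := Submodule.map_subtype_le _ _
  have heq : (LinearMap.range (h ^ k)).map Q.subtype = Q :=
    hle.eq_of_not_lt (hmin _ hmem)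
  rw [eq_top_iff]
  intro q _
  have hq : (q : Fin n → A) ∈ (LinearMap.range (h ^ k)).map Q.subtype := by
    rw [heq]; exact q.2
  obtain ⟨_, ⟨y, rfl⟩, hy⟩ := hq
  have hyq : (h ^ k) y = q := Subtype.ext hy
  obtain ⟨j, rfl⟩ : ∃ j, k = j + 1 := ⟨k - 1, by omega⟩
  rw [← hyq, pow_succ', Module.End.mul_apply]
  exact (g _).2

variable [IsArtinianRing A]

/-- The projective cover `P(M)` of a finitely generated module `M`. -/
def cover (M : FGModuleCat.{u} A) : FGModuleCat.{u} A :=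
  (exists_projectiveCover M).choose

/-- The covering map `P(M) → M`. -/
def coverMap (M : FGModuleCat.{u} A) : cover M →ₗ[A] M :=
  (exists_projectiveCover M).choose_spec.choose

theorem isProjectiveCover_coverMap (M : FGModuleCat.{u} A) : IsProjectiveCover (coverMap M) :=
  (exists_projectiveCover M).choose_spec.choose_spec

/-- The syzygy `Ω M`, the kernel of the projective cover of `M`. -/
def syzygy (M : FGModuleCat.{u} A) : FGModuleCat.{u} A :=
  FGModuleCat.of A (LinearMap.ker (coverMap M))

/-- The minimal projective presentation `P(Ω M) → P(M)` of `M`. -/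
def presentationMap (M : FGModuleCat.{u} A) : cover (syzygy M) →ₗ[A] cover M :=
  (LinearMap.ker (coverMap M)).subtype ∘ₗ coverMap (syzygy M)

end Cover

/-! ## The dualities `Hom_A(-, A)` and `D = Hom_K(-, K)` -/

section Duality

/-- The map of right `A`-modules `Hom_A(f, A) : Hom_A(Q, A) → Hom_A(P, A)`. -/
def homDualMap {A : Type u} [Ring A] {P Q : Type u} [AddCommGroup P] [Module A P]
    [AddCommGroup Q] [Module A Q] (f : P →ₗ[A] Q) : (Q →ₗ[A] A) →ₗ[Aᵐᵒᵖ] (P →ₗ[A] A) where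
  toFun φ := φ ∘ₗ f
  map_add' _ _ := rfl
  map_smul' _ _ := rfl

/-- The `K`-dual `D N = Hom_K(N, K)`, as an additive group. -/
def KDual (K N : Type u) [Field K] [AddCommGroup N] [Module K N] : Type u :=
  N →ₗ[K] K

variable (K : Type u) {A N : Type u} [Field K] [Ring A] [Algebra K A]
  [AddCommGroup N] [Module K N] [Module Aᵐᵒᵖ N] [IsScalarTower K Aᵐᵒᵖ N]

instance : AddCommGroup (KDual K N) :=
  inferInstanceAs (AddCommGroup (N →ₗ[K] K))

/-- The `K`-dual of a right `A`-module is a left `A`-module by `(a φ)(n) = φ (n a)`. -/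
instance : Module A (KDual K N) where
  smul a φ := show N →ₗ[K] K from
    { toFun := fun n => (show N →ₗ[K] K from φ) (op a • n)
      map_add' := fun m n => by rw [smul_add, map_add]
      map_smul' := fun k n => by
        rw [← algebraMap_smul Aᵐᵒᵖ k n, ← mul_smul, ← Algebra.commutes, mul_smul,
          algebraMap_smul, map_smul, RingHom.id_apply] }
  one_smul φ := LinearMap.ext fun n =>
    congrArg (show N →ₗ[K] K from φ) (one_smul Aᵐᵒᵖ n)
  mul_smul a b φ := LinearMap.ext fun n =>
    congrArg (show N →ₗ[K] K from φ) (mul_smul (op b) (op a) n)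
  smul_zero _ := rfl
  smul_add _ _ _ := rfl
  add_smul a b φ := LinearMap.ext fun n =>
    (congrArg (show N →ₗ[K] K from φ) (add_smul (op a) (op b) n)).trans
      (map_add (show N →ₗ[K] K from φ) _ _)
  zero_smul φ := LinearMap.ext fun n =>
    (congrArg (show N →ₗ[K] K from φ) (zero_smul Aᵐᵒᵖ n)).trans
      (map_zero (show N →ₗ[K] K from φ))

end Duality

/-! ## The Auslander–Reiten translations -/

section Translation

/-- The transpose `Tr M = coker (Hom_A(P₀, A) → Hom_A(P₁, A))`, a right `A`-module, for the
minimal projective presentation `P₁ → P₀ → M → 0`. -/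
abbrev Transpose {A : Type u} [Ring A] [IsArtinianRing A] (M : FGModuleCat.{u} A) : Type u :=
  (cover (syzygy M) →ₗ[A] A) ⧸ LinearMap.range (homDualMap (presentationMap M))

variable (K : Type u) {A : Type u} [Field K] [Ring A] [Algebra K A]

/-- The left `A`-module `DA = Hom_K(A, K)`. -/
def dualRegular (A : Type u) [Ring A] [Algebra K A] : ModuleCat.{u} A :=
  ModuleCat.of A (KDual K A)

variable [FiniteDimensional K A]

/-- The Auslander–Reiten translation `τ M = D Tr M`. -/
def tau (M : FGModuleCat.{u} A) : ModuleCat.{u} A :=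
  haveI : IsArtinianRing A := IsArtinianRing.of_finite K A
  ModuleCat.of A (KDual K (Transpose M))

/-- The 2-Auslander–Reiten translation `τ₂ = τ Ω`. -/
def tauTwo (M : FGModuleCat.{u} A) : ModuleCat.{u} A :=
  haveI : IsArtinianRing A := IsArtinianRing.of_finite K A
  tau K (syzygy M)

end Translation

/-! ## Cluster tilting and tilting -/

section Tilting

/-- `C ⊆ mod A` is a `d`-cluster-tilting subcategory:
`C = {X ∈ mod A | Ext^i(C, X) = 0 for 0 < i < d} = {X ∈ mod A | Ext^i(X, C) = 0 for 0 < i < d}`. -/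
structure IsClusterTilting {A : Type u} [Ring A] (d : ℕ)
    (C : ObjectProperty (FGModuleCat.{u} A)) : Prop where
  mem_iff_ext_left : ∀ X, C X ↔
    ∀ M, C M → ∀ i, 0 < i → i < d → Subsingleton (Abelian.Ext M.obj X.obj i)
  mem_iff_ext_right : ∀ X, C X ↔
    ∀ M, C M → ∀ i, 0 < i → i < d → Subsingleton (Abelian.Ext X.obj M.obj i)

/-- `M ∈ add T`: `M` is a direct summand of a finite direct sum of copies of `T`. -/
def IsInAdd {R : Type u} [Ring R] (T M : ModuleCat.{u} R) : Prop :=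
  ∃ (n : ℕ) (i : M →ₗ[R] (Fin n → T)) (p : (Fin n → T) →ₗ[R] M), p ∘ₗ i = LinearMap.id

/-- There is an exact sequence `0 → R → T₀ → T₁ → T₂ → 0` with `T₀, T₁, T₂ ∈ add T`. -/
def HasAddCoresolution {R : Type u} [Ring R] (T : ModuleCat.{u} R) : Prop :=
  ∃ (T₀ T₁ T₂ : ModuleCat.{u} R) (f : R →ₗ[R] T₀) (g : T₀ →ₗ[R] T₁) (h : T₁ →ₗ[R] T₂),
    IsInAdd T T₀ ∧ IsInAdd T T₁ ∧ IsInAdd T T₂ ∧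
    Function.Injective f ∧ Function.Exact f g ∧ Function.Exact g h ∧ Function.Surjective h

/-- `T` is a 2-tilting `R`-module. -/
structure IsTwoTilting {R : Type u} [Ring R] (T : ModuleCat.{u} R) : Prop where
  finite : Module.Finite R T
  projDim_le : HasProjectiveDimensionLE T 2
  rigid : ∀ i, 0 < i → i ≤ 2 → Subsingleton (Abelian.Ext T T i)
  coresolution : HasAddCoresolution T

/-- `T` is a `τ₂`-tilting `A`-module, with respect to the subcategory `C` of `mod A`. -/
structure IsTauTwoTilting (K : Type u) {A : Type u} [Field K] [Ring A] [Algebra K A]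
    [FiniteDimensional K A] (C : ObjectProperty (FGModuleCat.{u} A)) (T : FGModuleCat.{u} A) :
    Prop where
  mem : C T
  hom_eq_zero : Subsingleton (T.obj ⟶ tauTwo K T)
  coresolution : HasAddCoresolution T.obj

/-- A left `A`-module `T` as a module over `A / ann T`. -/
def overQuotientAnnihilator {A : Type u} [Ring A] (T : ModuleCat.{u} A) :
    ModuleCat.{u} (A ⧸ Module.annihilator A T) :=
  letI : Module (A ⧸ Module.annihilator A T) T := Module.quotientAnnihilator
  ModuleCat.of (A ⧸ Module.annihilator A T) T

end Tilting

end HigherAR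

end

/-!
Write `P₁ → P₀ → X → 0` for the minimal projective presentation of `X`. Tensor–hom adjunction and
`Hom_A(P, A) ⊗ Y ≅ Hom_A(P, Y)`, for `P` finitely generated projective, give
`Hom_A(Y, τ X) ≅ D coker (Hom_A(P₀, Y) → Hom_A(P₁, Y))`. So `Hom_A(Y, τ X) = 0` exactly when every
map `P₁ → Y` factors through `P₁ → P₀` (`subsingleton_hom_tau_iff`; the adjunction is unfolded with
dual bases in `hom_dual_coker_eq_zero_of_factor` and `exists_factor_of_hom_dual_coker`). With
`X = Ω T`, this criterion is used for two choices of `Y`.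

* For `Y = DA` the factorization property says that `P₁ → P₀` is injective
  (`forall_factor_dualRegular_iff`), that is, `Ω³ T = 0`, that is, `T` has projective dimension at
  most `2` (`hasProjectiveDimensionLE_two_iff`). If `T` is faithful, `DA` is generated by `T`, so
  `Hom_A(T, τ₂ T) = 0` forces `Hom_A(DA, τ₂ T) = 0` (`subsingleton_hom_dualRegular_of_faithful`).
* For `Y = T` it gives `Ext¹(Ω T, T) = 0`, which is `Ext²(T, T) = 0`
  (`subsingleton_ext_two_of_hom_tauTwo`). The vanishing of `Ext¹(T, T)` is part of the
  cluster-tilting condition.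

The coresolution of a `τ₂`-tilting module `T` embeds `A` in a power of `T`, so `T` is faithful and
`A → A / ann T` is an isomorphism, along which the tilting conditions are transported
(`isTwoTilting_overQuotientAnnihilator`).
-/

namespace HigherAR

open CategoryTheory MulOpposite

/-! ### Homomorphisms into the dual of a cokernel -/

/-- The dual basis of a finitely generated projective module. -/
theorem exists_dualBasis {A P : Type u} [Ring A] [AddCommGroup P] [Module A P]
    [Module.Finite A P] [Module.Projective A P] :
    ∃ (n : ℕ) (e : Fin n → P) (c : Fin n → P →ₗ[A] A), ∀ x, ∑ i, c i x • e i = x := by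
  obtain ⟨n, f, g, -, -, hfg⟩ := Module.Finite.exists_comp_eq_id_of_projective A P
  refine ⟨n, fun i => f (Pi.single i 1), fun i => LinearMap.proj i ∘ₗ g, fun x => ?_⟩
  conv_rhs => rw [← LinearMap.id_apply (R := A) x, ← hfg, LinearMap.comp_apply,
    pi_eq_sum_univ' (g x)]
  simp [map_sum]

section Factor

variable (K : Type u) {A P Q Y M : Type u} [Field K] [Ring A] [Algebra K A]
  [AddCommGroup P] [Module A P] [AddCommGroup Q] [Module A Q] [AddCommGroup Y] [Module A Y]
  [AddCommGroup M] [Module A M]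

/-- One half of the Auslander–Reiten formula. In terms of tensor products,
`Hom_A(Y, D coker d*) ≅ D (coker d* ⊗ Y) ≅ D coker (Hom_A(Q, Y) → Hom_A(P, Y))`; here `h` is
evaluated through the linear form on `Hom_A(P, Y)` that it corresponds to. -/
theorem hom_dual_coker_eq_zero_of_factor [Module.Finite A P] [Module.Projective A P]
    [Module.Finite A Q] [Module.Projective A Q] (d : P →ₗ[A] Q)
    (hd : ∀ u : P →ₗ[A] Y, ∃ v : Q →ₗ[A] Y, v ∘ₗ d = u)
    (h : Y →ₗ[A] KDual K ((P →ₗ[A] A) ⧸ LinearMap.range (homDualMap d))) : h = 0 := by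
  obtain ⟨n, e, c, hc⟩ := exists_dualBasis (A := A) (P := P)
  obtain ⟨m, e', c', hc'⟩ := exists_dualBasis (A := A) (P := Q)
  let π := (LinearMap.range (homDualMap d)).mkQ
  let ev (y : Y) : ((P →ₗ[A] A) ⧸ LinearMap.range (homDualMap d)) →ₗ[K] K := h y
  have ev_add (y z) : ev (y + z) = ev y + ev z := map_add h y z
  have ev_zero : ev 0 = 0 := map_zero h
  have ev_sum {ι : Type} (s : Finset ι) (y : ι → Y) : ev (∑ i ∈ s, y i) = ∑ i ∈ s, ev (y i) :=
    map_sum (⟨⟨ev, ev_zero⟩, ev_add⟩ : Y →+ _) y s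
  have ev_smul (a : A) (y : Y) (φ : P →ₗ[A] A) : ev (a • y) (π φ) = ev y (π (op a • φ)) := by
    rw [map_smul]
    exact LinearMap.congr_fun (map_smul h a y) (π φ)
  have expand (φ : P →ₗ[A] A) : ∑ k, op (φ (e k)) • c k = φ := by
    ext x
    conv_rhs => rw [← hc x]
    simp
  -- The trace form `u ↦ ∑ h (u eₖ) (cₖ)` vanishes on the maps factoring through `d`.
  have key (v : Q →ₗ[A] Y) : ∑ k, ev (v (d (e k))) (π (c k)) = 0 := by
    have h1 (k) : ev (v (d (e k))) (π (c k)) =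
        ∑ i, ev (v (e' i)) (π (op (c' i (d (e k))) • c k)) := by
      conv_lhs => rw [← hc' (d (e k)), map_sum, ev_sum, LinearMap.sum_apply]
      simp only [map_smul v, ev_smul]
    simp only [h1]
    rw [Finset.sum_comm]
    refine Finset.sum_eq_zero fun i _ => ?_
    rw [← map_sum, ← map_sum]
    have h2 : π (∑ k, op (c' i (d (e k))) • c k) = 0 :=
      (Submodule.Quotient.mk_eq_zero _).2 ⟨c' i, (expand (c' i ∘ₗ d)).symm⟩
    rw [h2, map_zero]
  ext y
  refine LinearMap.ext fun q => ?_
  obtain ⟨φ, rfl⟩ := (LinearMap.range (homDualMap d)).mkQ_surjective q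
  obtain ⟨v, hv⟩ := hd (LinearMap.toSpanSingleton A Y y ∘ₗ φ)
  have h3 := key v
  have h4 (k) : v (d (e k)) = φ (e k) • y := LinearMap.congr_fun hv (e k)
  simp only [h4, ev_smul] at h3
  rw [← map_sum, ← map_sum, expand] at h3
  exact h3

/-- The other half of the Auslander–Reiten formula: a linear form on `Hom_A(P, Y)` that vanishes on
the maps factoring through `d` induces a homomorphism `Y → D coker d*`. -/
theorem exists_factor_of_hom_dual_coker [Module.Finite A P] [Module.Projective A P]
    (d : P →ₗ[A] Q)
    [hd : Subsingleton (Y →ₗ[A] KDual K ((P →ₗ[A] A) ⧸ LinearMap.range (homDualMap d)))]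
    (u : P →ₗ[A] Y) : ∃ v : Q →ₗ[A] Y, v ∘ₗ d = u := by
  let _ : Module K Y := Module.compHom Y (algebraMap K A)
  have : IsScalarTower K A Y := .of_algebraMap_smul fun _ _ => rfl
  have : SMulCommClass A K Y := IsScalarTower.to_smulCommClass'
  let R : Submodule K (P →ₗ[A] Y) := LinearMap.range (LinearMap.lcomp K Y d)
  by_contra hu
  have huR : u ∉ R := fun ⟨v, hv⟩ => hu ⟨v, hv⟩
  obtain ⟨l, hl, hlR⟩ := Submodule.exists_le_ker_of_notMem huR
  -- The rank-one maps `x ↦ φ x • y` span `Hom_A(P, Y)`.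
  let r (y : Y) : (P →ₗ[A] A) →ₗ[K] (P →ₗ[A] Y) :=
    { toFun := fun φ => LinearMap.toSpanSingleton A Y y ∘ₗ φ
      map_add' := fun φ ψ => by ext x; simp [add_smul]
      map_smul' := fun k φ => by ext x; simp }
  have hr (y : Y) : (LinearMap.range (homDualMap d)).restrictScalars K ≤
      LinearMap.ker (l ∘ₗ r y) := by
    rintro _ ⟨φ, rfl⟩
    exact hlR ⟨LinearMap.toSpanSingleton A Y y ∘ₗ φ, rfl⟩
  let h : Y →ₗ[A] KDual K ((P →ₗ[A] A) ⧸ LinearMap.range (homDualMap d)) :=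
    { toFun := fun y =>
        (((LinearMap.range (homDualMap d)).restrictScalars K).liftQ (l ∘ₗ r y) (hr y)
          : (P →ₗ[A] A) ⧸ LinearMap.range (homDualMap d) →ₗ[K] K)
      map_add' := fun y z => LinearMap.ext fun q => by
        obtain ⟨φ, rfl⟩ := (LinearMap.range (homDualMap d)).mkQ_surjective q
        exact (congrArg l (show r (y + z) φ = r y φ + r z φ by ext x; simp [r])).trans
          (map_add l _ _)
      map_smul' := fun a y => LinearMap.ext fun q => by
        obtain ⟨φ, rfl⟩ := (LinearMap.range (homDualMap d)).mkQ_surjective q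
        exact congrArg l (show r (a • y) φ = r y (op a • φ) by ext x; simp [r, mul_smul]) }
  have hlr (y : Y) (φ : P →ₗ[A] A) : l (r y φ) = 0 := by
    have h1 : h y = 0 := by rw [Subsingleton.elim h 0, LinearMap.zero_apply]
    exact LinearMap.congr_fun h1 ((LinearMap.range (homDualMap d)).mkQ φ)
  obtain ⟨n, e, c, hc⟩ := exists_dualBasis (A := A) (P := P)
  have hu' : u = ∑ i, r (u (e i)) (c i) := by
    ext x
    conv_lhs => rw [← hc x]
    simp [r]
  apply hl
  rw [hu', map_sum]
  exact Finset.sum_eq_zero fun i _ => hlr _ _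

/-- The `A`-linear map `P → DA` attached to a `K`-linear form `ξ` on `P`, namely
`x ↦ (a ↦ ξ (a x))`. -/
def toDualRegular {K : Type u} [Field K] [Algebra K A] [Module K P] [IsScalarTower K A P]
    (ξ : P →ₗ[K] K) : P →ₗ[A] KDual K A where
  toFun x := ξ ∘ₗ (LinearMap.toSpanSingleton A P x).restrictScalars K
  map_add' x y := LinearMap.ext fun a =>
    (congrArg ξ (smul_add a x y)).trans (map_add ξ _ _)
  map_smul' b x := LinearMap.ext fun a => congrArg ξ (mul_smul a b x).symm

/-- `DA` is an injective cogenerator: `Hom_A(d, DA)` is the `K`-dual of `d`. -/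
theorem forall_factor_dualRegular_iff (d : P →ₗ[A] Q) :
    (∀ u : P →ₗ[A] KDual K A, ∃ v : Q →ₗ[A] KDual K A, v ∘ₗ d = u) ↔
      Function.Injective d := by
  let _ : Module K P := Module.compHom P (algebraMap K A)
  let _ : Module K Q := Module.compHom Q (algebraMap K A)
  have : IsScalarTower K A P := .of_algebraMap_smul fun _ _ => rfl
  have : IsScalarTower K A Q := .of_algebraMap_smul fun _ _ => rfl
  constructor
  · intro hd
    rw [injective_iff_map_eq_zero]
    intro x hx
    refine (Module.forall_dual_apply_eq_zero_iff K x).1 fun ξ => ?_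
    obtain ⟨v, hv⟩ := hd (toDualRegular ξ)
    have h1 : toDualRegular (A := A) ξ x = 0 := by
      rw [← hv, LinearMap.comp_apply, hx, map_zero]
    have h2 : ξ ((1 : A) • x) = 0 := LinearMap.congr_fun h1 (1 : A)
    rwa [one_smul] at h2
  · intro hd u
    obtain ⟨r, hr⟩ := (d.restrictScalars K).exists_leftInverse_of_injective
      (LinearMap.ker_eq_bot.2 hd)
    let ξ : P →ₗ[K] K :=
      { toFun := fun x => (show A →ₗ[K] K from u x) 1
        map_add' := fun x y => LinearMap.congr_fun (map_add u x y) 1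
        map_smul' := fun k x => by
          have h1 := LinearMap.congr_fun (map_smul u (algebraMap K A k) x) (1 : A)
          have h2 : (show A →ₗ[K] K from u x) (1 * algebraMap K A k) =
              k • (show A →ₗ[K] K from u x) 1 := by
            rw [← map_smul, Algebra.smul_def, one_mul, mul_one]
          exact h1.trans h2 }
    refine ⟨toDualRegular (ξ ∘ₗ r), ?_⟩
    ext x
    refine LinearMap.ext fun a => ?_
    have h1 : r (a • d x) = a • x := by
      rw [← map_smul]
      exact LinearMap.congr_fun hr (a • x)
    have h2 : (show A →ₗ[K] K from u (a • x)) 1 = (show A →ₗ[K] K from u x) (1 * a) :=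
      LinearMap.congr_fun (map_smul u a x) (1 : A)
    rw [one_mul] at h2
    exact (congrArg ξ h1).trans h2

/-- If `Y` is faithful, `DA` is generated by `Y`: the images of the maps `toDualRegular ξ`
together span `DA`, since an element of `A` orthogonal to all of them annihilates `Y`. -/
theorem subsingleton_hom_dualRegular_of_faithful [FiniteDimensional K A]
    (hY : Module.annihilator A Y = ⊥) [Subsingleton (Y →ₗ[A] M)] :
    Subsingleton (KDual K A →ₗ[A] M) := by
  let _ : Module K Y := Module.compHom Y (algebraMap K A)
  have : IsScalarTower K A Y := .of_algebraMap_smul fun _ _ => rfl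
  refine subsingleton_of_forall_eq 0 fun f => ?_
  let W : Submodule K (Module.Dual K A) :=
    { carrier := {χ | f (show KDual K A from χ) = 0}
      add_mem' := fun {χ ψ} hχ hψ => by
        have h1 : f (show KDual K A from χ) + f (show KDual K A from ψ) = 0 := by
          rw [show f (show KDual K A from χ) = 0 from hχ,
            show f (show KDual K A from ψ) = 0 from hψ, add_zero]
        exact (map_add f _ _).trans h1
      zero_mem' := map_zero f
      smul_mem' := fun k χ hχ => by
        have h1 : (show KDual K A from k • χ) = algebraMap K A k • (show KDual K A from χ) := by
          refine LinearMap.ext fun a => ?_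
          have h2 : χ (a * algebraMap K A k) = k • χ a := by
            rw [← map_smul, Algebra.smul_def, Algebra.commutes]
          exact h2.symm
        have h3 : f (algebraMap K A k • (show KDual K A from χ)) = 0 := by
          rw [map_smul, show f (show KDual K A from χ) = 0 from hχ, smul_zero]
        exact (congrArg f h1).trans h3 }
  have hW : W.dualCoannihilator = ⊥ := by
    refine (Submodule.eq_bot_iff _).2 fun a ha => ?_
    rw [← Submodule.mem_bot (R := A), ← hY, Module.mem_annihilator]
    intro y
    refine (Module.forall_dual_apply_eq_zero_iff K _).1 fun ξ => ?_
    refine (Submodule.mem_dualCoannihilator a).1 ha (toDualRegular ξ y) ?_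
    exact LinearMap.congr_fun (Subsingleton.elim (f ∘ₗ toDualRegular (A := A) ξ) 0) y
  have hW' : W = ⊤ := by
    rw [← Subspace.dualCoannihilator_dualAnnihilator_eq (W := W), hW,
      Submodule.dualAnnihilator_bot]
  ext χ
  have : (show Module.Dual K A from χ) ∈ W := hW' ▸ Submodule.mem_top
  exact this

end Factor

/-! ### Syzygies, projective dimension and extensions -/

section Homological

variable {A : Type u} [Ring A] [IsArtinianRing A]

instance (M : FGModuleCat.{u} A) : Module.Projective A (cover M) :=
  (isProjectiveCover_coverMap M).projective

instance (M : FGModuleCat.{u} A) : Projective (coverMap M).shortComplexKer.X₂ :=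
  (IsProjective.iff_projective (R := A) (cover M)).1 inferInstance

theorem shortExact_syzygy (M : FGModuleCat.{u} A) : (coverMap M).shortComplexKer.ShortExact :=
  LinearMap.shortExact_shortComplexKer (isProjectiveCover_coverMap M).surjective

theorem hasProjectiveDimensionLE_succ_iff_syzygy (M : FGModuleCat.{u} A) (n : ℕ) :
    HasProjectiveDimensionLE M.obj (n + 1) ↔ HasProjectiveDimensionLE (syzygy M).obj n :=
  (shortExact_syzygy M).hasProjectiveDimensionLT_X₃_iff n inferInstance

/-- A projective module is its own projective cover, because the kernel of its cover is both a
direct summand and superfluous. -/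
theorem hasProjectiveDimensionLE_zero_iff_injective (M : FGModuleCat.{u} A) :
    HasProjectiveDimensionLE M.obj 0 ↔ Function.Injective (coverMap M) := by
  have hM := isProjectiveCover_coverMap M
  rw [← projective_iff_hasProjectiveDimensionLE_zero, ← LinearMap.ker_eq_bot]
  refine Iff.trans (IsProjective.iff_projective (R := A) M).symm ⟨fun _ => ?_, fun h => ?_⟩
  · obtain ⟨s, hs⟩ := Module.projective_lifting_property (coverMap M) LinearMap.id hM.surjective
    have hs' (m) : coverMap M (s m) = m := LinearMap.congr_fun hs m
    -- The image of a section is a complement of the superfluous kernel.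
    have htop : LinearMap.range s = ⊤ := by
      refine hM.superfluous _ (eq_top_iff.2 fun x _ => ?_)
      refine Submodule.mem_sup.2 ⟨s (coverMap M x), ⟨_, rfl⟩, x - s (coverMap M x), ?_, by abel⟩
      rw [LinearMap.mem_ker, map_sub, hs', sub_self]
    refine (Submodule.eq_bot_iff _).2 fun x hx => ?_
    obtain ⟨m, rfl⟩ : x ∈ LinearMap.range s := htop ▸ Submodule.mem_top
    rw [LinearMap.mem_ker, hs'] at hx
    rw [hx, map_zero]
  · exact Module.Projective.of_equiv (LinearEquiv.ofBijective (coverMap M)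
      ⟨LinearMap.ker_eq_bot.1 h, hM.surjective⟩)

theorem hasProjectiveDimensionLE_two_iff (M : FGModuleCat.{u} A) :
    HasProjectiveDimensionLE M.obj 2 ↔ Function.Injective (presentationMap (syzygy M)) := by
  rw [hasProjectiveDimensionLE_succ_iff_syzygy, hasProjectiveDimensionLE_succ_iff_syzygy,
    hasProjectiveDimensionLE_zero_iff_injective]
  exact (Function.Injective.of_comp_iff (Submodule.injective_subtype _) _).symm

theorem subsingleton_ext_two_of_syzygy (M : FGModuleCat.{u} A) (Y : ModuleCat.{u} A)
    [Subsingleton (Abelian.Ext (syzygy M).obj Y 1)] : Subsingleton (Abelian.Ext M.obj Y 2) := by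
  refine subsingleton_of_forall_eq 0 fun x => ?_
  obtain ⟨y, rfl⟩ := Abelian.Ext.contravariant_sequence_exact₃ (shortExact_syzygy M) Y x
    (Abelian.Ext.eq_zero_of_projective _) (n₀ := 1) rfl
  rw [show y = 0 from Subsingleton.elim (α := Abelian.Ext (syzygy M).obj Y 1) _ _,
    Abelian.Ext.comp_zero]

/-- A map `Ω M → Y` extends to `P(M)` as soon as its composite with `P(Ω M) → Ω M` factors through
`P(M)`, because `P(Ω M) → Ω M` is surjective. -/
theorem subsingleton_ext_one_of_factor (M : FGModuleCat.{u} A) (Y : ModuleCat.{u} A)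
    (h : ∀ u : cover (syzygy M) →ₗ[A] Y, ∃ v : cover M →ₗ[A] Y, v ∘ₗ presentationMap M = u) :
    Subsingleton (Abelian.Ext M.obj Y 1) := by
  refine subsingleton_of_forall_eq 0 fun x => ?_
  obtain ⟨y, rfl⟩ := Abelian.Ext.contravariant_sequence_exact₃ (shortExact_syzygy M) Y x
    (Abelian.Ext.eq_zero_of_projective _) (n₀ := 0) rfl
  obtain ⟨g, rfl⟩ := (Abelian.Ext.mk₀_bijective _ _).2 y
  obtain ⟨v, hv⟩ := h (g.hom ∘ₗ coverMap (syzygy M))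
  have hg : g = (coverMap M).shortComplexKer.f ≫ ModuleCat.ofHom v := by
    ext z
    obtain ⟨p, rfl⟩ := (isProjectiveCover_coverMap (syzygy M)).surjective z
    exact (LinearMap.congr_fun hv p).symm
  rw [hg, ← Abelian.Ext.mk₀_comp_mk₀, (shortExact_syzygy M).extClass_comp_assoc]

end Homological

/-! ### Homomorphisms into the Auslander–Reiten translations -/

section Translation

variable (K : Type u) {A : Type u} [Field K] [Ring A] [Algebra K A] [FiniteDimensional K A]

/-- `Hom_A(Y, τ M) = 0` if and only if every map from `P(Ω M)` to `Y` extends along the minimal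
projective presentation of `M`. -/
theorem subsingleton_hom_tau_iff [IsArtinianRing A] (M : FGModuleCat.{u} A) (Y : ModuleCat.{u} A) :
    Subsingleton (Y ⟶ tau K M) ↔
      ∀ u : cover (syzygy M) →ₗ[A] Y, ∃ v : cover M →ₗ[A] Y, v ∘ₗ presentationMap M = u := by
  refine (ModuleCat.homEquiv (M := Y) (N := tau K M)).subsingleton_congr.trans
    ⟨fun h => ?_, fun h => ?_⟩
  · exact exists_factor_of_hom_dual_coker K (presentationMap M) (hd := h)
  · exact subsingleton_of_forall_eq 0 fun f =>
      hom_dual_coker_eq_zero_of_factor K (presentationMap M) h f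

theorem hasProjectiveDimensionLE_two_iff_hom_dualRegular (T : FGModuleCat.{u} A) :
    HasProjectiveDimensionLE T.obj 2 ↔ Subsingleton (dualRegular K A ⟶ tauTwo K T) := by
  have : IsArtinianRing A := IsArtinianRing.of_finite K A
  rw [hasProjectiveDimensionLE_two_iff]
  exact (forall_factor_dualRegular_iff K _).symm.trans
    (subsingleton_hom_tau_iff K (syzygy T) (dualRegular K A)).symm

theorem hasProjectiveDimensionLE_two_of_faithful (T : FGModuleCat.{u} A)
    (hT : Module.annihilator A T = ⊥) (h : Subsingleton (T.obj ⟶ tauTwo K T)) :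
    HasProjectiveDimensionLE T.obj 2 := by
  rw [hasProjectiveDimensionLE_two_iff_hom_dualRegular K]
  have : Subsingleton (T.obj →ₗ[A] tauTwo K T) := ModuleCat.homEquiv.symm.subsingleton
  have : Subsingleton (dualRegular K A →ₗ[A] tauTwo K T) :=
    subsingleton_hom_dualRegular_of_faithful K (M := tauTwo K T) hT
  exact (ModuleCat.homEquiv (M := dualRegular K A)).subsingleton

/-- The dimension shift `Ext²(T, Y) = Ext¹(Ω T, Y)`, with the vanishing of the latter read off from
`Hom_A(Y, τ Ω T) = 0`. -/
theorem subsingleton_ext_two_of_hom_tauTwo (T : FGModuleCat.{u} A) (Y : ModuleCat.{u} A)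
    (h : Subsingleton (Y ⟶ tauTwo K T)) : Subsingleton (Abelian.Ext T.obj Y 2) := by
  have : IsArtinianRing A := IsArtinianRing.of_finite K A
  have := subsingleton_ext_one_of_factor (syzygy T) Y
    ((subsingleton_hom_tau_iff K (syzygy T) Y).1 h)
  exact subsingleton_ext_two_of_syzygy T Y

end Translation

/-! ### Transport along ring isomorphisms -/

section ChangeOfRings

theorem subsingleton_ext_restrictScalars_iff {R S : Type u} [Ring R] [Ring S] (e : R ≃+* S)
    (X Y : ModuleCat.{u} S) (n : ℕ) :
    Subsingleton (Abelian.Ext ((ModuleCat.restrictScalars e.toRingHom).obj X)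
      ((ModuleCat.restrictScalars e.toRingHom).obj Y) n) ↔ Subsingleton (Abelian.Ext X Y n) :=
  (Equiv.ofBijective _ (Functor.mapExt_bijective_of_preservesProjectiveObjects
    (ModuleCat.restrictScalars.{u} e.toRingHom) X Y n)).symm.subsingleton_congr

theorem hasAddCoresolution_of_restrictScalars {R S : Type u} [Ring R] [Ring S] (e : R ≃+* S)
    {T : ModuleCat.{u} S}
    (hT : HasAddCoresolution ((ModuleCat.restrictScalars e.toRingHom).obj T)) :
    HasAddCoresolution T := by
  obtain ⟨T₀, T₁, T₂, f, g, h, h₀, h₁, h₂, hf, hfg, hgh, hh⟩ := hT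
  let F := ModuleCat.restrictScalars.{u} e.symm.toRingHom
  have smul_T (s : S) (t : T) :
      (show T from e.symm s • (show (ModuleCat.restrictScalars e.toRingHom).obj T from t)) =
        s • t :=
    congrArg (· • t) (e.apply_symm_apply s)
  have add {M : ModuleCat.{u} R}
      (hM : IsInAdd ((ModuleCat.restrictScalars e.toRingHom).obj T) M) : IsInAdd T (F.obj M) := by
    obtain ⟨n, i, p, hpi⟩ := hM
    refine ⟨n,
      { toFun := i
        map_add' := map_add i
        map_smul' := fun s m => (map_smul i (e.symm s) m).trans (funext fun _ => smul_T _ _) },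
      { toFun := p
        map_add' := map_add p
        map_smul' := fun s m => ?_ },
      LinearMap.ext fun m => LinearMap.congr_fun hpi m⟩
    exact (congrArg p (funext fun j => (smul_T s (m j)).symm)).trans
      (map_smul p (e.symm s)
        (show Fin n → (ModuleCat.restrictScalars e.toRingHom).obj T from m))
  refine ⟨F.obj T₀, F.obj T₁, F.obj T₂,
    { toFun := fun s => f (e.symm s)
      map_add' := fun s t => by rw [map_add, map_add]; rfl
      map_smul' := fun s t => by
        rw [smul_eq_mul, map_mul, ← smul_eq_mul, map_smul]; rfl },
    (F.map (ModuleCat.ofHom g)).hom, (F.map (ModuleCat.ofHom h)).hom,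
    add h₀, add h₁, add h₂, hf.comp e.symm.injective, fun t => ?_, hgh, hh⟩
  exact (hfg t).trans (e.symm.surjective.range_comp f ▸ Iff.rfl)

/-- A ring that embeds in a power of `T` acts faithfully on `T`. -/
theorem annihilator_eq_bot_of_hasAddCoresolution {R : Type u} [Ring R] {T : ModuleCat.{u} R}
    (hT : HasAddCoresolution T) : Module.annihilator R T = ⊥ := by
  obtain ⟨T₀, -, -, f, -, -, ⟨n, i, p, hpi⟩, -, -, hf, -⟩ := hT
  have hi : Function.Injective i := Function.LeftInverse.injective (LinearMap.congr_fun hpi)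
  refine (Submodule.eq_bot_iff _).2 fun a ha => hf (hi ?_)
  rw [map_zero, map_zero, ← mul_one a, ← smul_eq_mul, map_smul, map_smul]
  exact funext fun j => Module.mem_annihilator.1 ha _

/-- A faithful module is a 2-tilting module over `R / ann T` as soon as it is one over `R`: the
projection `R → R / ann T` is then a ring isomorphism, and every clause is invariant under it. -/
theorem isTwoTilting_overQuotientAnnihilator {R : Type u} [Ring R] {T : ModuleCat.{u} R}
    (hT : IsTwoTilting T) (hann : Module.annihilator R T = ⊥) :
    IsTwoTilting (overQuotientAnnihilator T) := by
  let e : R ≃+* R ⧸ Module.annihilator R T :=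
    RingEquiv.ofBijective (Ideal.Quotient.mk _)
      ⟨(RingHom.injective_iff_ker_eq_bot _).2 (Ideal.mk_ker.trans hann),
        Ideal.Quotient.mk_surjective⟩
  have := RingHomInvPair.of_ringEquiv e
  have := RingHomInvPair.of_ringEquiv e.symm
  let ε : T ≃ₛₗ[RingHomClass.toRingHom e] overQuotientAnnihilator T :=
    { AddEquiv.refl T with map_smul' := fun _ _ => rfl }
  have := hT.finite
  have := hT.projDim_le
  -- Restricting `overQuotientAnnihilator T` along `e` gives back `T` definitionally.
  exact
    { finite := Module.Finite.of_surjective ε.toLinearMap ε.surjective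
      projDim_le := ModuleCat.hasProjectiveDimensionLE_of_semiLinearEquiv e ε 2
      rigid := fun i h0 h2 =>
        (subsingleton_ext_restrictScalars_iff e _ _ i).1 (hT.rigid i h0 h2)
      coresolution := hasAddCoresolution_of_restrictScalars e hT.coresolution }

end ChangeOfRings

end HigherAR

theorem mainTheorem4 {K A : Type u} [Field K] [Ring A] [Algebra K A] [FiniteDimensional K A]
    (C : CategoryTheory.ObjectProperty (FGModuleCat.{u} A))
    (hC : HigherAR.IsClusterTilting 2 C) :
    (∀ T : FGModuleCat.{u} A, C T →
      (CategoryTheory.HasProjectiveDimensionLE T.obj 2 ↔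
        Subsingleton (HigherAR.dualRegular K A ⟶ HigherAR.tauTwo K T))) ∧
    (∀ T : FGModuleCat.{u} A, C T → Module.annihilator A T = ⊥ →
      Subsingleton (T.obj ⟶ HigherAR.tauTwo K T) →
        CategoryTheory.HasProjectiveDimensionLE T.obj 2) ∧
    (∀ T : FGModuleCat.{u} A, HigherAR.IsTauTwoTilting K C T →
      HigherAR.IsTwoTilting (HigherAR.overQuotientAnnihilator T.obj)) := by
  refine ⟨fun T _ => HigherAR.hasProjectiveDimensionLE_two_iff_hom_dualRegular K T,
    fun T _ => HigherAR.hasProjectiveDimensionLE_two_of_faithful K T, fun T hT => ?_⟩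
  have hann : Module.annihilator A T.obj = ⊥ :=
    HigherAR.annihilator_eq_bot_of_hasAddCoresolution hT.coresolution
  refine HigherAR.isTwoTilting_overQuotientAnnihilator
    { finite := inferInstance
      projDim_le := HigherAR.hasProjectiveDimensionLE_two_of_faithful K T hann hT.hom_eq_zero
      rigid := fun i h0 h2 => ?_
      coresolution := hT.coresolution } hann
  obtain rfl | rfl : i = 1 ∨ i = 2 := by omega
  · exact (hC.mem_iff_ext_left T).1 hT.mem T hT.mem 1 one_pos one_lt_two
  · exact HigherAR.subsingleton_ext_two_of_hom_tauTwo K T T.obj hT.hom_eq_zero
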